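/- Let $X$ be a complex Banach space with open unit ball $B$, closed unit ball $\bar B$ and closed bidual unit ball $\bar B^{**}\subset X^{**}$; $X$ is regarded as a subspace of $X^{**}$. Let $H^\infty(B)$ be the algebra of bounded holomorphic functions $B\to\mathbb C$ with the sup norm, and let $A_u(B)\subset H^\infty(B)$ be the subalgebra of uniformly continuous functions. The functions in $A_u(B)$ are regarded as functions on $\bar B$ through their continuous extensions, and as functions on $\bar B^{**}$ through their Aron--Berner extensions $\tilde g$: on the open bidual ball $\tilde g$ is the sum of the Aron--Berner (Arens) extensions of the Taylor polynomials of $g$ at $0$, and $\tilde g$ is extended continuously to $\bar B^{**}$. A point $x$ of a metric space $\Omega$ is a peak point for a space $\mathcal F$ of functions $\Omega\to\mathbb C$ if some $f\in\mathcal F$ satisfies $f(x)=1$ and $|f(y)|<1$ for all $y\in\Omega\setminus\{x\}$; it is a strong peak point if some $f\in\mathcal F$ satisfies $f(x)=1$ and for every $\varepsilon>0$ there is $\delta>0$ such that $d(x,y)>\varepsilon$ implies $|f(y)|<1-\delta$. For an algebra $H$ with $A_u(B)\subset H\subset H^\infty(B)$, let $M_H$ be the set of nonzero continuous multiplicative linear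 functionals on $H$, let $\hat f(\tau)=\tau(f)$ ($\tau\in M_H$) be the Gelfand transform of $f\in H$, and for $z\in\bar B^{**}$ let the polynomial fiber $M_z^{\mathcal P}(H)$ be the set of all $\tau\in M_H$ with $\tau(g)=\tilde g(z)$ for all $g\in A_u(B)$. **Theorem.** Suppose that $x\in\bar B$ is a strong peak point for $A_u(B)$ as a function space on $\bar B$. Then $x$ is a peak point for $A_u(B)$ as a function space on $\bar B^{**}$. Moreover, for every algebra $H$ with $A_u(B)\subset H\subset H^\infty(B)$ (in particular for $H=H^\infty(B)$) and every $f\in H$ that extends continuously to $B\cup\{x\}$, the Gelfand transform $\hat f$ is constant on $M_x^{\mathcal P}(H)$. -/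

import Mathlib

open scoped BoundedContinuousFunction

noncomputable section

namespace PolyFiber

/-- The open unit ball `B` of `X`, as a metric space. -/
abbrev OpenBall (X : Type*) [NormedAddCommGroup X] : Type _ := Metric.ball (0 : X) 1

/-- The closed unit ball of `X`, as a metric space. -/
abbrev ClosedBall (X : Type*) [NormedAddCommGroup X] : Type _ := Metric.closedBall (0 : X) 1

theorem ClosedBall.norm_le {X : Type*} [NormedAddCommGroup X] (x : ClosedBall X) : ‖x.1‖ ≤ 1 :=
  mem_closedBall_zero_iff.1 x.2

/-- A vector of norm at most one, as a point of the closed ball. -/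
def ClosedBall.mk {X : Type*} [NormedAddCommGroup X] (x : X) (hx : ‖x‖ ≤ 1) : ClosedBall X :=
  ⟨x, mem_closedBall_zero_iff.2 hx⟩

/-- The bidual `X**`. -/
abbrev Bidual (X : Type*) [NormedAddCommGroup X] [NormedSpace ℂ X] : Type _ :=
  StrongDual ℂ (StrongDual ℂ X)

/-- The inclusion of the open ball into the closed ball. -/
def toClosed {X : Type*} [NormedAddCommGroup X] (y : OpenBall X) : ClosedBall X :=
  ⟨y.1, Metric.ball_subset_closedBall y.2⟩

theorem denseRange_toClosed {Y : Type*} [NormedAddCommGroup Y] [NormedSpace ℂ Y] :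
    DenseRange (toClosed : OpenBall Y → ClosedBall Y) := by
  let _ : NormedSpace ℝ Y := NormedSpace.restrictScalars ℝ ℂ Y
  intro z
  rw [closure_subtype, ← Set.range_comp]
  have : Set.range (Subtype.val ∘ (toClosed : OpenBall Y → ClosedBall Y)) = Metric.ball 0 1 :=
    Subtype.range_val
  rw [this, closure_ball _ one_ne_zero]
  exact z.2

/-- The canonical embedding of the closed ball of `X` into the closed ball of `X**`. -/
def toBidualBall {X : Type*} [NormedAddCommGroup X] [NormedSpace ℂ X] (x : ClosedBall X) :
    ClosedBall (Bidual X) :=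
  ClosedBall.mk (NormedSpace.inclusionInDoubleDual ℂ X x.1)
    ((NormedSpace.double_dual_bound ℂ X x.1).trans (ClosedBall.norm_le x))

/-- A function on the open ball, extended by zero to the whole space. Only its values on the open
ball matter below; this is needed to speak about derivatives. -/
def zeroExt {X : Type*} [NormedAddCommGroup X] (f : OpenBall X → ℂ) : X → ℂ :=
  Function.extend Subtype.val f 0

theorem zeroExt_apply {X : Type*} [NormedAddCommGroup X] (f : OpenBall X → ℂ)
    {y : X} (hy : y ∈ Metric.ball (0 : X) 1) : zeroExt f y = f ⟨y, hy⟩ :=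
  Subtype.val_injective.extend_apply f 0 ⟨y, hy⟩

/-- `f : B → ℂ` is holomorphic: near each point of the open ball it is the sum of a power series
of continuous homogeneous polynomials. -/
def IsHolo {X : Type*} [NormedAddCommGroup X] [NormedSpace ℂ X] (f : OpenBall X → ℂ) : Prop :=
  AnalyticOnNhd ℂ (zeroExt f) (Metric.ball (0 : X) 1)

/-- The algebra `H^∞(B)` of bounded holomorphic functions on the open ball, with the sup norm. -/
def HInf (X : Type*) [NormedAddCommGroup X] [NormedSpace ℂ X] :
    Subalgebra ℂ (OpenBall X →ᵇ ℂ) where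
  carrier := {f | IsHolo f}
  mul_mem' {f g} hf hg := (AnalyticOnNhd.mul hf hg).congr Metric.isOpen_ball fun y hy => by
    simp [zeroExt_apply, hy]
  add_mem' {f g} hf hg := (AnalyticOnNhd.add hf hg).congr Metric.isOpen_ball fun y hy => by
    simp [zeroExt_apply, hy]
  algebraMap_mem' c := (analyticOnNhd_const (v := c)).congr Metric.isOpen_ball fun y hy => by
    rw [zeroExt_apply _ hy]; rfl

/-- The algebra `A_u(B)` of (bounded) uniformly continuous holomorphic functions on the open
ball. -/
def Au (X : Type*) [NormedAddCommGroup X] [NormedSpace ℂ X] :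
    Subalgebra ℂ (OpenBall X →ᵇ ℂ) where
  carrier := {f | IsHolo f ∧ UniformContinuous f}
  mul_mem' {f g} hf hg := ⟨(HInf X).mul_mem hf.1 hg.1, by
    obtain ⟨C, hC⟩ := f.isBounded_range.exists_norm_le
    obtain ⟨D, hD⟩ := g.isBounded_range.exists_norm_le
    rw [Metric.uniformContinuous_iff]
    intro ε hε
    have hC' : ∀ y, ‖f y‖ ≤ |C| := fun y => (hC _ ⟨y, rfl⟩).trans (le_abs_self C)
    have hD' : ∀ y, ‖g y‖ ≤ |D| := fun y => (hD _ ⟨y, rfl⟩).trans (le_abs_self D)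
    have hpos : 0 < |C| + |D| + 1 := by positivity
    obtain ⟨δ₁, h₁, H₁⟩ := Metric.uniformContinuous_iff.1 hf.2 _ (div_pos hε hpos)
    obtain ⟨δ₂, h₂, H₂⟩ := Metric.uniformContinuous_iff.1 hg.2 _ (div_pos hε hpos)
    refine ⟨min δ₁ δ₂, lt_min h₁ h₂, fun {a b} hab => ?_⟩
    have e₁ := H₁ (hab.trans_le (min_le_left _ _))
    have e₂ := H₂ (hab.trans_le (min_le_right _ _))
    rw [dist_eq_norm] at e₁ e₂ ⊢
    have key : (f * g) a - (f * g) b = f a * (g a - g b) + (f a - f b) * g b := by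
      simp only [BoundedContinuousFunction.coe_mul, Pi.mul_apply]; ring
    rw [key]
    calc ‖f a * (g a - g b) + (f a - f b) * g b‖
        ≤ ‖f a‖ * ‖g a - g b‖ + ‖f a - f b‖ * ‖g b‖ :=
          (norm_add_le _ _).trans (by rw [norm_mul, norm_mul])
      _ ≤ |C| * (ε / (|C| + |D| + 1)) + (ε / (|C| + |D| + 1)) * |D| := by
          gcongr
          · exact hC' a
          · exact hD' b
      _ = ε * ((|C| + |D|) / (|C| + |D| + 1)) := by ring
      _ < ε * 1 := by
          gcongr
          rw [div_lt_one hpos]; linarith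
      _ = ε := mul_one ε⟩
  add_mem' {f g} hf hg := ⟨(HInf X).add_mem hf.1 hg.1, hf.2.add hg.2⟩
  algebraMap_mem' c := ⟨(HInf X).algebraMap_mem c, uniformContinuous_const⟩

/-- The Arens extension of a continuous `n`-linear form `A` on `X`, evaluated at
`z = (z 0, …, z (n - 1))` in `(X**)ⁿ`. It is obtained one variable at a time: for fixed `x`, extend
the `(n - 1)`-linear form `A(x, ·)`, and evaluate it at `(z 1, …, z (n - 1))`; the result is a
continuous linear functional of `x`, to which `z 0` is applied (this is the weak-star continuous
extension in the first variable). It is linear and continuous in `A`. -/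
def arens {X : Type*} [NormedAddCommGroup X] [NormedSpace ℂ X] :
    (n : ℕ) → (Fin n → Bidual X) → ((X [×n]→L[ℂ] ℂ) →L[ℂ] ℂ)
  | 0, _ => ((continuousMultilinearCurryFin0 ℂ X ℂ).toContinuousLinearEquiv :
      (X [×0]→L[ℂ] ℂ) →L[ℂ] ℂ)
  | n + 1, z =>
    (z 0).comp
      ((ContinuousLinearMap.compL ℂ X (X [×n]→L[ℂ] ℂ) ℂ (arens n (Fin.tail z))).comp
        ((continuousMultilinearCurryLeftEquiv ℂ
          (fun _ : Fin (n + 1) => X) ℂ).toContinuousLinearEquiv :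
            (X [×(n + 1)]→L[ℂ] ℂ) →L[ℂ] (X →L[ℂ] (X [×n]→L[ℂ] ℂ))))

/-- The symmetric `n`-linear form of the `n`-th Taylor polynomial at the origin of a function on
the open ball. -/
def taylorForm {X : Type*} [NormedAddCommGroup X] [NormedSpace ℂ X] (g : OpenBall X → ℂ) (n : ℕ) :
    X [×n]→L[ℂ] ℂ :=
  (n.factorial : ℂ)⁻¹ • iteratedFDeriv ℂ n (zeroExt g) 0

/-- The Aron-Berner extension to `X**` of the `n`-th Taylor polynomial of `g` at the origin: the
restriction of the Arens extension of its symmetric form to the diagonal. -/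
def taylorAB {X : Type*} [NormedAddCommGroup X] [NormedSpace ℂ X] (g : OpenBall X → ℂ) (n : ℕ)
    (z : Bidual X) : ℂ :=
  arens n (fun _ => z) (taylorForm g n)

/-- `G` is the Aron-Berner extension of `g` to the closed ball of `X**`: on the open ball it is the
sum of the Aron-Berner extensions of the Taylor polynomials of `g`, and it is continuous up to the
boundary. These conditions determine `G`, by `IsAronBerner.unique`. -/
def IsAronBerner {X : Type*} [NormedAddCommGroup X] [NormedSpace ℂ X] (g : OpenBall X → ℂ)
    (G : ClosedBall (Bidual X) → ℂ) : Prop :=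
  Continuous G ∧ ∀ z : OpenBall (Bidual X), HasSum (fun n => taylorAB g n z.1) (G (toClosed z))

theorem IsAronBerner.unique {X : Type*} [NormedAddCommGroup X] [NormedSpace ℂ X]
    {g : OpenBall X → ℂ} {G G' : ClosedBall (Bidual X) → ℂ} (h : IsAronBerner g G)
    (h' : IsAronBerner g G') : G = G' :=
  denseRange_toClosed.equalizer h.1 h'.1 (funext fun z => (h.2 z).unique (h'.2 z))

/-- `A_u(B)` as a function space on the closed ball of `X`: the continuous extensions to the closed
ball of the functions in `A_u(B)`. -/
def auClosedBall (X : Type*) [NormedAddCommGroup X] [NormedSpace ℂ X] : Set (ClosedBall X → ℂ) :=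
  {F | Continuous F ∧ ∃ g ∈ Au X, ∀ y : OpenBall X, F (toClosed y) = g y}

/-- `A_u(B)` as a function space on the closed ball of `X**`: the Aron-Berner extensions of the
functions in `A_u(B)`. -/
def auBidualBall (X : Type*) [NormedAddCommGroup X] [NormedSpace ℂ X] :
    Set (ClosedBall (Bidual X) → ℂ) :=
  {G | ∃ g ∈ Au X, IsAronBerner g G}

/-- Peak points of a function space on a metric space. -/
def IsPeakPoint {Ω : Type*} [MetricSpace Ω] (H : Set (Ω → ℂ)) (x : Ω) : Prop :=
  ∃ f ∈ H, f x = 1 ∧ ∀ y, y ≠ x → ‖f y‖ < 1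

/-- Strong peak points of a function space on a metric space. -/
def IsStrongPeakPoint {Ω : Type*} [MetricSpace Ω] (H : Set (Ω → ℂ)) (x : Ω) : Prop :=
  ∃ f ∈ H, f x = 1 ∧ ∀ ε > 0, ∃ δ > 0, ∀ y, ε < dist x y → ‖f y‖ < 1 - δ

/-- For an algebra `H` of bounded functions on the open ball that contains `A_u(B)`, the polynomial
fiber of the spectrum of `H` over a point `z` of the closed ball of `X**`: the characters of `H`
whose restriction to `A_u(B)` is `g ↦ G z`, with `G` the Aron-Berner extension of `g`. -/
def polynomialFiber {X : Type*} [NormedAddCommGroup X] [NormedSpace ℂ X]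
    (H : Subalgebra ℂ (OpenBall X →ᵇ ℂ)) (hH : Au X ≤ H) (z : ClosedBall (Bidual X)) :
    Set (WeakDual.characterSpace ℂ H) :=
  {τ | ∀ g : Au X, ∀ G : ClosedBall (Bidual X) → ℂ, IsAronBerner (g : OpenBall X →ᵇ ℂ) G →
    τ (Subalgebra.inclusion hH g) = G z}

/-- A function on the open ball `B` extends continuously to `B ∪ {x}`. -/
def ExtendsContinuouslyTo {X : Type*} [NormedAddCommGroup X] (f : OpenBall X → ℂ) (x : X) : Prop :=
  ∃ F : X → ℂ, ContinuousOn F (insert x (Metric.ball (0 : X) 1)) ∧ ∀ y : OpenBall X, F y = f y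

end PolyFiber

end

/-!
The peak function `g ∈ A_u(B)` of `x` serves for both parts of the theorem; the work is to show that
it has an Aron-Berner extension `G` to the closed bidual ball, and that the values of `G` are limits
of values of `g`.

The tool is the Davie-Gamelin approximation (`exists_arensDiag_approx`): for `z` in the closed
bidual ball, finitely many symmetric forms `A` and a functional `ℓ`, some `y` in the closed ball of
`X` has `A(y, …, y)` close to the Arens extension of `A` at `(z, …, z)`, and `ℓ y` close to `z ℓ`.
To find `y`, one moves from `z` to `X` in `N` steps, each replacing `z / N` by `x / N` with `x` in
the ball of `X`. On the span of `X` and `z` the Arens extension of a symmetric form is symmetric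
(`bidual_comp_comm`), so the first order change in such a step is `x - z` evaluated at a functional
known in advance, and Goldstine's theorem (`exists_closedBall_approx`) provides an `x` that makes it
small. The second order terms add up to `O(1 / N)` (`exists_arensDiag_remainder`).

Consequently Cauchy's estimates pass to the extended Taylor polynomials, and the extended Taylor
series converges in the open bidual ball. Differences of its dilations by factors less than one are
bounded by differences of dilations of `g`, which are small because `g` is uniformly continuous.
So the dilations converge uniformly on the closed bidual ball, and the limit is `G`
(`exists_isAronBerner`).

If `|G z| ≥ 1`, then there are points `u` of the ball with `g u` close to `G z` and `ℓ u` close to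
`z ℓ`. As `x` is a strong peak point, these `u` are close to `x`, so `z ℓ = ℓ x`, and `z = x`. For
the second part, let `E` be the continuous extension of `f` to `x`. Then `gⁿ (f - E x)` tends to
zero uniformly on the ball, while a character `τ` in the fiber over `x` has `τ g = G x = 1`; so
`τ f = E x`.
-/

noncomputable section

namespace PolyFiber

open Filter Topology

variable {X : Type*} [NormedAddCommGroup X] [NormedSpace ℂ X]

/-- The canonical embedding `X → X**`. -/
local notation "ι" => NormedSpace.inclusionInDoubleDual ℂ X

/-! ### Goldstine's theorem -/

theorem norm_inclusion_le (y : X) : ‖ι y‖ ≤ ‖y‖ := NormedSpace.double_dual_bound ℂ X y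

/-- Goldstine's theorem, for finitely many functionals: otherwise the point `(z (φ i))ᵢ` is
separated in `κ → ℂ` from the image of the unit ball, and the separating functional pulls back to
a functional on `X` that violates `‖z‖ ≤ 1`. -/
theorem exists_closedBall_approx (z : Bidual X) (hz : ‖z‖ ≤ 1) {κ : Type*} [Finite κ]
    (φ : κ → StrongDual ℂ X) {ε : ℝ} (hε : 0 < ε) :
    ∃ x : X, ‖x‖ ≤ 1 ∧ ∀ i, ‖φ i x - z (φ i)‖ < ε := by
  have := Fintype.ofFinite κ
  let _ : NormedSpace ℝ X := NormedSpace.restrictScalars ℝ ℂ X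
  let Φ : X →L[ℂ] (κ → ℂ) := ContinuousLinearMap.pi φ
  let C : Set (κ → ℂ) := Φ '' Metric.closedBall (0 : X) 1
  have hC : Convex ℝ C := (convex_closedBall (0 : X) 1).linear_image
    (Φ.toLinearMap.restrictScalars ℝ)
  have key : (fun i => z (φ i)) ∈ closure C := by
    by_contra hnot
    obtain ⟨f, u, hu, hfu⟩ := RCLike.geometric_hahn_banach_closed_point (𝕜 := ℂ) hC.closure
      isClosed_closure hnot
    have hfz : f (fun i => z (φ i)) = z (f.comp Φ) := by
      classical
      have hf : ∀ v : κ → ℂ, f v = ∑ i, v i * f (Pi.single i 1) := fun v => by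
        conv_lhs => rw [← Finset.univ_sum_single v, map_sum]
        refine Finset.sum_congr rfl fun i _ => ?_
        rw [← smul_eq_mul, ← map_smul, ← Pi.single_smul, smul_eq_mul, mul_one]
      have : f.comp Φ = ∑ i, f (Pi.single i 1) • φ i := by
        ext x
        rw [ContinuousLinearMap.comp_apply, hf]
        simp [Φ, mul_comm]
      rw [this, hf, map_sum]
      simp [mul_comm]
    have hu0 : 0 ≤ u := by
      have := hu 0 (subset_closure ⟨0, by simp, by simp⟩)
      simpa using this.le
    have hnorm : ‖f.comp Φ‖ ≤ u := by
      refine ContinuousLinearMap.opNorm_le_of_unit_norm hu0 fun x hx => ?_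
      -- rotating `x` makes the value of the functional real and nonnegative
      obtain ⟨c, hc, hcx⟩ := RCLike.exists_norm_eq_mul_self (f (Φ x))
      have := hu (Φ (c • x)) (subset_closure ⟨c • x, by simp [norm_smul, hc, hx], rfl⟩)
      rw [map_smul, map_smul, smul_eq_mul, ← hcx, RCLike.ofReal_re] at this
      exact this.le
    have h1 : RCLike.re (z (f.comp Φ)) ≤ u := calc
      RCLike.re (z (f.comp Φ)) ≤ ‖z (f.comp Φ)‖ := RCLike.re_le_norm _
      _ ≤ 1 * ‖f.comp Φ‖ := z.le_of_opNorm_le hz _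
      _ ≤ u := by rwa [one_mul]
    rw [hfz] at hfu
    linarith
  obtain ⟨_, ⟨x, hx, rfl⟩, hd⟩ := Metric.mem_closure_iff.1 key ε hε
  refine ⟨x, mem_closedBall_zero_iff.1 hx, fun i => ?_⟩
  rw [← dist_eq_norm, dist_comm]
  exact (dist_le_pi_dist _ _ i).trans_lt hd

/-! ### Symmetric forms and the Arens extension on the diagonal -/

/-- A form is symmetric if it is invariant under all permutations of its variables. -/
def IsSymm {n : ℕ} (A : X [×n]→L[ℂ] ℂ) : Prop :=
  ∀ (v : Fin n → X) (σ : Equiv.Perm (Fin n)), A (v ∘ σ) = A v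

theorem IsSymm.curryLeft {n : ℕ} {A : X [×(n + 1)]→L[ℂ] ℂ} (hA : IsSymm A) (x : X) :
    IsSymm (A.curryLeft x) := fun v σ => by
  have := hA (Fin.cons x v) (Equiv.Perm.decomposeFin.symm (0, σ))
  rw [ContinuousMultilinearMap.curryLeft_apply, ContinuousMultilinearMap.curryLeft_apply, ← this]
  congr 1
  ext i
  refine Fin.cases ?_ (fun i => ?_) i <;> simp [Fin.cons_zero]

theorem IsSymm.curryLeft_comm {n : ℕ} {A : X [×(n + 2)]→L[ℂ] ℂ} (hA : IsSymm A) (x y : X) :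
    (A.curryLeft x).curryLeft y = (A.curryLeft y).curryLeft x := by
  ext v
  have := hA (Fin.cons x (Fin.cons y v)) (Equiv.swap 0 1)
  simp only [ContinuousMultilinearMap.curryLeft_apply]
  rw [← this]
  congr 1
  ext i
  refine Fin.cases ?_ (fun i => Fin.cases ?_ (fun i => ?_) i) i
  · simp
  · simp
  · rw [Function.comp_apply, Equiv.swap_apply_of_ne_of_ne (Fin.succ_ne_zero _)]
    · simp
    · exact fun h => Fin.succ_ne_zero i (Fin.succ_injective _ h)

/-- The Arens extension of `n`-linear forms, on the diagonal. -/
abbrev arensDiag (n : ℕ) (w : Bidual X) : (X [×n]→L[ℂ] ℂ) →L[ℂ] ℂ := arens n fun _ => w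

theorem arensDiag_zero_apply (w w' : Bidual X) (A : X [×0]→L[ℂ] ℂ) :
    arensDiag 0 w A = arensDiag 0 w' A := rfl

theorem arensDiag_succ_apply (n : ℕ) (w : Bidual X) (A : X [×(n + 1)]→L[ℂ] ℂ) :
    arensDiag (n + 1) w A = w ((arensDiag n w).comp A.curryLeft) := rfl

theorem arensDiag_inclusion (n : ℕ) (y : X) (A : X [×n]→L[ℂ] ℂ) :
    arensDiag n (ι y) A = A fun _ => y := by
  induction n with
  | zero => exact congrArg A (Subsingleton.elim _ _)
  | succ n ih =>
    rw [arensDiag_succ_apply, NormedSpace.dual_def, ContinuousLinearMap.comp_apply, ih,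
      ContinuousMultilinearMap.curryLeft_apply]
    congr 1
    ext i
    refine Fin.cases ?_ (fun i => ?_) i <;> simp

theorem arensDiag_smul (n : ℕ) (c : ℂ) (w : Bidual X) (A : X [×n]→L[ℂ] ℂ) :
    arensDiag n (c • w) A = c ^ n * arensDiag n w A := by
  induction n with
  | zero => simp [arensDiag_zero_apply (c • w) w]
  | succ n ih =>
    have : (arensDiag n (c • w)).comp A.curryLeft = c ^ n • (arensDiag n w).comp A.curryLeft := by
      ext x
      simp [ih]
    rw [arensDiag_succ_apply, arensDiag_succ_apply, this, map_smul]
    simp [pow_succ]; ring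

theorem norm_arensDiag_le (n : ℕ) {w : Bidual X} (hw : ‖w‖ ≤ 1) : ‖arensDiag n w‖ ≤ 1 := by
  induction n with
  | zero =>
    refine ContinuousLinearMap.opNorm_le_bound _ zero_le_one fun A => ?_
    rw [one_mul]
    exact ((continuousMultilinearCurryFin0 ℂ X ℂ).norm_map A).le
  | succ n ih =>
    refine ContinuousLinearMap.opNorm_le_bound _ zero_le_one fun A => ?_
    rw [arensDiag_succ_apply]
    calc ‖w ((arensDiag n w).comp A.curryLeft)‖ ≤ 1 * (‖arensDiag n w‖ * ‖A.curryLeft‖) :=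
          (w.le_of_opNorm_le hw _).trans (by gcongr; exact ContinuousLinearMap.opNorm_comp_le _ _)
      _ ≤ 1 * (1 * ‖A‖) := by gcongr; exact A.curryLeft_norm.le
      _ = 1 * ‖A‖ := by rw [one_mul]

theorem continuous_arens (n : ℕ) : Continuous fun z : Fin n → Bidual X => arens n z := by
  induction n with
  | zero => exact continuous_const
  | succ n ih =>
    have h : Continuous fun z : Fin (n + 1) → Bidual X => arens n (Fin.tail z) :=
      ih.comp (continuous_pi fun i => continuous_apply i.succ)
    exact (continuous_apply (0 : Fin (n + 1))).clm_comp
      (((ContinuousLinearMap.compL ℂ X (X [×n]→L[ℂ] ℂ) ℂ).continuous.comp h).clm_comp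
        continuous_const)

theorem continuous_arensDiag (n : ℕ) : Continuous fun z : Bidual X => arensDiag n z :=
  (continuous_arens n).comp (continuous_pi fun _ => continuous_id)

/-! ### Symmetry of the Arens extension on the span of `X` and one point -/

/-- The span of `X` and one further point `z` in the bidual. -/
def spanWith (z : Bidual X) : Submodule ℂ (Bidual X) :=
  LinearMap.range (ι : X →L[ℂ] Bidual X).toLinearMap ⊔ ℂ ∙ z

/-- The two Arens extensions of a symmetric bilinear form agree on the span of `X` and a single
point `z`: the two orders of evaluation differ only when both entries are genuinely in the bidual,
and here the entries outside `X` are multiples of the same `z`. On all of `X**` this fails. -/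
theorem bidual_comp_comm {z w d : Bidual X} (hw : w ∈ spanWith z) (hd : d ∈ spanWith z)
    (B : X →L[ℂ] X →L[ℂ] ℂ) (hB : ∀ x y, B x y = B y x) :
    w (d.comp B) = d (w.comp B) := by
  have hι : ∀ y, (ι y).comp B = B y := fun y => by
    ext x
    simp [NormedSpace.dual_def, hB x y]
  obtain ⟨_, ⟨y, rfl⟩, _, hs, rfl⟩ := Submodule.mem_sup.1 hw
  obtain ⟨s, rfl⟩ := Submodule.mem_span_singleton.1 hs
  obtain ⟨_, ⟨y', rfl⟩, _, hs', rfl⟩ := Submodule.mem_sup.1 hd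
  obtain ⟨s', rfl⟩ := Submodule.mem_span_singleton.1 hs'
  simp only [ContinuousLinearMap.coe_coe, ContinuousLinearMap.add_comp,
    ContinuousLinearMap.smul_comp, add_apply, map_add, map_smul,
    smul_apply, hι, NormedSpace.dual_def, hB y' y, smul_eq_mul,
    ContinuousLinearMap.comp_apply]
  ring

/-! ### Davie-Gamelin approximation -/

theorem norm_curryLeft_apply_le {n : ℕ} (A : X [×(n + 1)]→L[ℂ] ℂ) (x : X) :
    ‖A.curryLeft x‖ ≤ ‖A‖ * ‖x‖ :=
  A.curryLeft.le_of_opNorm_le A.curryLeft_norm.le x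

/-- First order expansion of the Arens extension of a symmetric form along a line `w + t d` in the
span of `X` and `z`. The constant is uniform in the form and in the points. The linear term is
the functional `d` applied to a fixed element of the dual of `X`; this uses symmetry on the span,
and makes the linear term small when `d = x - z` with `x` weak-star close to `z`. -/
theorem exists_arensDiag_remainder (n : ℕ) : ∃ C : ℝ, 0 ≤ C ∧ ∀ z w d : Bidual X,
    w ∈ spanWith z → d ∈ spanWith z → ‖w‖ ≤ 1 → ‖d‖ ≤ 2 → ∀ t : ℂ, ‖t‖ ≤ 1 →
      ∀ A : X [×(n + 1)]→L[ℂ] ℂ, IsSymm A →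
        ‖arensDiag (n + 1) (w + t • d) A - arensDiag (n + 1) w A
          - t * ((n + 1 : ℕ) * d ((arensDiag n w).comp A.curryLeft))‖ ≤ C * ‖t‖ ^ 2 * ‖A‖ := by
  induction n with
  | zero =>
    refine ⟨0, le_rfl, fun z w d _ _ _ _ t _ A _ => ?_⟩
    have : arensDiag 0 (w + t • d) = arensDiag 0 w := rfl
    simp only [arensDiag_succ_apply, this]
    simp
  | succ n ih =>
    obtain ⟨C, hC, ih⟩ := ih
    refine ⟨3 * C + 4 * (n + 1 : ℕ), by positivity, fun z w d hw hd hw1 hd2 t ht A hA => ?_⟩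
    -- the functionals to which `w` and `d` are applied in the definition of the Arens extension
    let L : StrongDual ℂ X := (arensDiag (n + 1) w).comp A.curryLeft
    let Lt : StrongDual ℂ X := (arensDiag (n + 1) (w + t • d)).comp A.curryLeft
    let B : X →L[ℂ] X →L[ℂ] ℂ :=
      (ContinuousLinearMap.compL ℂ X (X [×n]→L[ℂ] ℂ) ℂ (arensDiag n w)).comp
        (((continuousMultilinearCurryLeftEquiv ℂ (fun _ : Fin (n + 1) => X)
          ℂ).toContinuousLinearEquiv : (X [×(n + 1)]→L[ℂ] ℂ) →L[ℂ] _).comp A.curryLeft)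
    have hB : ∀ x, B x = (arensDiag n w).comp (A.curryLeft x).curryLeft := fun x => rfl
    let D : StrongDual ℂ X := d.comp B
    let R : StrongDual ℂ X := Lt - L - (t * (n + 1 : ℕ)) • D
    have hR : ‖R‖ ≤ C * ‖t‖ ^ 2 * ‖A‖ := by
      refine R.opNorm_le_bound (by positivity) fun x => ?_
      have := ih z w d hw hd hw1 hd2 t ht (A.curryLeft x) (hA.curryLeft x)
      have e : R x = arensDiag (n + 1) (w + t • d) (A.curryLeft x)
          - arensDiag (n + 1) w (A.curryLeft x)
          - t * ((n + 1 : ℕ) * d ((arensDiag n w).comp (A.curryLeft x).curryLeft)) := by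
        rw [← mul_assoc]; rfl
      rw [e, mul_assoc]
      exact this.trans (by gcongr; exact norm_curryLeft_apply_le A x)
    have hD : ‖D‖ ≤ 2 * ‖A‖ := by
      refine D.opNorm_le_bound (by positivity) fun x => ?_
      calc ‖d (B x)‖ ≤ 2 * ‖B x‖ := d.le_of_opNorm_le hd2 _
        _ ≤ 2 * (1 * (‖A‖ * ‖x‖)) := by
          gcongr
          rw [hB]
          refine (ContinuousLinearMap.opNorm_comp_le _ _).trans ?_
          gcongr
          · exact norm_arensDiag_le n hw1
          · exact ((A.curryLeft x).curryLeft_norm.le).trans (norm_curryLeft_apply_le A x)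
        _ = 2 * ‖A‖ * ‖x‖ := by ring
    have hwD : w D = d L := by
      have := bidual_comp_comm hw hd B fun x y => by
        simp only [hB, ContinuousLinearMap.comp_apply, hA.curryLeft_comm x y]
      rw [this]
      rfl
    have hLt : Lt = R + L + (t * (n + 1 : ℕ)) • D := by simp only [R]; abel
    have key : arensDiag (n + 2) (w + t • d) A - arensDiag (n + 2) w A
          - t * ((n + 1 + 1 : ℕ) * d ((arensDiag (n + 1) w).comp A.curryLeft))
        = w R + t * d R + t * (t * ((n + 1 : ℕ) * d D)) := by
      have e₁ : arensDiag (n + 2) (w + t • d) A = (w + t • d) Lt := rfl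
      have e₂ : arensDiag (n + 2) w A = w L := rfl
      have e₃ : (arensDiag (n + 1) w).comp A.curryLeft = L := rfl
      rw [e₁, e₂, e₃, hLt]
      simp only [add_apply, smul_apply, map_add, map_smul, smul_eq_mul, hwD]
      push_cast
      ring
    rw [key]
    have hdR : ‖d R‖ ≤ 2 * (C * ‖t‖ ^ 2 * ‖A‖) := d.le_of_opNorm_le_of_le hd2 hR
    have hwR : ‖w R‖ ≤ 1 * (C * ‖t‖ ^ 2 * ‖A‖) := w.le_of_opNorm_le_of_le hw1 hR
    have hdD : ‖d D‖ ≤ 2 * (2 * ‖A‖) := d.le_of_opNorm_le_of_le hd2 hD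
    calc _ ≤ ‖w R‖ + ‖t‖ * ‖d R‖ + ‖t‖ * (‖t‖ * ((n + 1 : ℕ) * ‖d D‖)) := by
          refine (norm_add₃_le).trans (le_of_eq ?_)
          simp only [norm_mul, Complex.norm_natCast]
      _ ≤ 1 * (C * ‖t‖ ^ 2 * ‖A‖) + 1 * (2 * (C * ‖t‖ ^ 2 * ‖A‖))
          + ‖t‖ * (‖t‖ * ((n + 1 : ℕ) * (2 * (2 * ‖A‖)))) := by gcongr
      _ = _ := by ring

/-- Moving from `w` to `w + t d` changes the extension of a symmetric form by at most
`|t| n |d φ| + C |t|²`, where the functional `φ` does not depend on `d` and `t`, and `C` does not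
depend on `w`. -/
theorem exists_arensDiag_increment {n : ℕ} {A : X [×n]→L[ℂ] ℂ} (hA : IsSymm A) :
    ∃ C : ℝ, 0 ≤ C ∧ ∀ z w : Bidual X, w ∈ spanWith z → ‖w‖ ≤ 1 → ∃ φ : StrongDual ℂ X,
      ∀ d ∈ spanWith z, ‖d‖ ≤ 2 → ∀ t : ℂ, ‖t‖ ≤ 1 →
        ‖arensDiag n (w + t • d) A - arensDiag n w A‖ ≤ ‖t‖ * (n * ‖d φ‖) + C * ‖t‖ ^ 2 := by
  cases n with
  | zero =>
    refine ⟨0, le_rfl, fun z w _ _ => ⟨0, fun d _ _ t _ => ?_⟩⟩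
    rw [arensDiag_zero_apply (w + t • d) w]
    simp
  | succ n =>
    obtain ⟨C, hC, h⟩ := exists_arensDiag_remainder (X := X) n
    refine ⟨C * ‖A‖, by positivity, fun z w hw hw1 =>
      ⟨(arensDiag n w).comp A.curryLeft, fun d hd hd2 t ht => ?_⟩⟩
    have h1 := h z w d hw hd hw1 hd2 t ht A hA
    have h2 := norm_le_norm_sub_add (arensDiag (n + 1) (w + t • d) A - arensDiag (n + 1) w A)
      (t * ((n + 1 : ℕ) * d ((arensDiag n w).comp A.curryLeft)))
    rw [norm_mul, norm_mul, Complex.norm_natCast] at h2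
    linarith

/-- The path from `z` to `X` after `k` of `N` steps. Each step replaces `(1 / N) z` by `(1 / N) x`,
with `x` chosen by Goldstine's theorem for the functionals that control the first order change at
the current point. The hypothesis `hinc` is the conclusion of `exists_arensDiag_increment` with one
constant for all the forms. -/
theorem exists_arensDiag_replace {z : Bidual X} (hz : ‖z‖ ≤ 1) {κ : Type*} [Finite κ]
    {n : κ → ℕ} {A : ∀ i, X [×(n i)]→L[ℂ] ℂ} (ℓ : StrongDual ℂ X)
    {K : ℝ} (hK : 0 ≤ K) (hn : ∀ i, n i ≤ K)
    (hinc : ∀ i, ∀ w : Bidual X, w ∈ spanWith z → ‖w‖ ≤ 1 → ∃ φ : StrongDual ℂ X,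
      ∀ d ∈ spanWith z, ‖d‖ ≤ 2 → ∀ t : ℂ, ‖t‖ ≤ 1 →
        ‖arensDiag (n i) (w + t • d) (A i) - arensDiag (n i) w (A i)‖
          ≤ ‖t‖ * (n i * ‖d φ‖) + K * ‖t‖ ^ 2)
    {ε : ℝ} (hε : 0 < ε) {N : ℕ} (hN : 0 < N) (k : ℕ) (hk : k ≤ N) :
    ∃ y : X, ‖y‖ ≤ k / N ∧ ‖ℓ y - (k / N : ℂ) * z ℓ‖ ≤ k / N * ε ∧
      ∀ i, ‖arensDiag (n i) (ι y + (1 - k / N : ℂ) • z) (A i) - arensDiag (n i) z (A i)‖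
        ≤ k / N * (K * ε + K / N) := by
  induction k with
  | zero => exact ⟨0, by simp, by simp, fun i => by simp⟩
  | succ k ih =>
    obtain ⟨y, hy, hℓ, hy'⟩ := ih (by omega)
    have hN' : (0 : ℝ) < N := by exact_mod_cast hN
    have hkN : (k : ℝ) / N ≤ 1 := (div_le_one hN').2 (by exact_mod_cast (by omega : k ≤ N))
    have hιmem : ∀ y : X, ι y ∈ spanWith z := fun y =>
      Submodule.mem_sup_left ⟨y, rfl⟩
    have hzmem : z ∈ spanWith z := Submodule.mem_sup_right (Submodule.mem_span_singleton_self z)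
    set w : Bidual X := ι y + (1 - k / N : ℂ) • z with hw
    have hwmem : w ∈ spanWith z := add_mem (hιmem y) (Submodule.smul_mem _ _ hzmem)
    have hcoef : ‖(1 - k / N : ℂ)‖ = 1 - k / N := by
      rw [← Complex.ofReal_natCast, ← Complex.ofReal_natCast, ← Complex.ofReal_div,
        ← Complex.ofReal_one, ← Complex.ofReal_sub, Complex.norm_real, Real.norm_of_nonneg]
      linarith
    have hw1 : ‖w‖ ≤ 1 := calc
      ‖w‖ ≤ ‖ι y‖ + ‖(1 - k / N : ℂ)‖ * ‖z‖ := 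
        (norm_add_le (ι y) _).trans (add_le_add_right (z.opNorm_smul_le _) _)
      _ ≤ k / N + (1 - k / N) * 1 := by
        rw [hcoef]
        gcongr
        exact (norm_inclusion_le y).trans hy
      _ = 1 := by ring
    choose φ hφ using fun i => hinc i w hwmem hw1
    obtain ⟨x, hx, hxφ⟩ := exists_closedBall_approx z hz
      (fun o : Option κ => o.elim ℓ φ) hε
    have htn : ‖(1 / N : ℂ)‖ = 1 / N := by simp
    refine ⟨y + (1 / N : ℂ) • x, ?_, ?_, fun i => ?_⟩
    · refine (norm_add_le _ _).trans ?_
      rw [norm_smul, htn]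
      push_cast
      calc ‖y‖ + 1 / N * ‖x‖ ≤ k / N + 1 / N * 1 := by gcongr
        _ = (k + 1) / N := by ring
    · have e : ℓ (y + (1 / N : ℂ) • x) - ((k + 1 : ℕ) / N : ℂ) * z ℓ
          = (ℓ y - (k / N : ℂ) * z ℓ) + (1 / N : ℂ) * (ℓ x - z ℓ) := by
        rw [map_add, map_smul, smul_eq_mul]; push_cast; ring
      rw [e]
      refine (norm_add_le _ _).trans ?_
      rw [norm_mul, htn]
      have := (hxφ none).le
      simp only [Option.elim] at this
      push_cast
      calc _ ≤ k / N * ε + 1 / N * ε := by gcongr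
        _ = _ := by ring
    · have hd2 : ‖ι x - z‖ ≤ 2 :=
        (norm_sub_le (ι x) z).trans (by linarith [norm_inclusion_le x])
      have e : ι (y + (1 / N : ℂ) • x) + (1 - (k + 1 : ℕ) / N : ℂ) • z
          = w + (1 / N : ℂ) • (ι x - z) := by
        rw [hw, map_add, map_smul]
        ext ψ
        simp only [add_apply, smul_apply, sub_apply, smul_eq_mul]
        push_cast
        ring
      have hdmem : ι x - z ∈ spanWith z := by
        have : ι x - z = ι x + (-1 : ℂ) • z := by
          ext ψ
          simp only [add_apply, smul_apply, sub_apply, smul_eq_mul]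
          ring
        rw [this]
        exact add_mem (hιmem x) (Submodule.smul_mem _ _ hzmem)
      have h1 := hφ i (ι x - z) hdmem hd2 (1 / N : ℂ)
        (htn.le.trans ((div_le_one hN').2 (Nat.one_le_cast.2 hN)))
      have h2 : ‖(ι x - z) (φ i)‖ ≤ ε := (hxφ (some i)).le
      rw [e]
      refine (norm_sub_le_norm_sub_add_norm_sub _ (arensDiag (n i) w (A i)) _).trans ?_
      rw [htn] at h1
      push_cast
      calc _ ≤ (1 / N * (n i * ‖(ι x - z) (φ i)‖) + K * (1 / N) ^ 2)
            + k / N * (K * ε + K / N) := add_le_add h1 (hy' i)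
        _ ≤ (1 / N * (K * ε) + K * (1 / N) ^ 2) + k / N * (K * ε + K / N) := by
          gcongr
          exact hn i
        _ = _ := by ring

/-- **Davie-Gamelin approximation**: finitely many polynomials, with their Aron-Berner extensions
at a point `z` of the closed bidual ball, and a functional are simultaneously approximated at a
point of the closed ball of `X`. -/
theorem exists_arensDiag_approx {z : Bidual X} (hz : ‖z‖ ≤ 1) {κ : Type*} [Finite κ]
    {n : κ → ℕ} {A : ∀ i, X [×(n i)]→L[ℂ] ℂ} (hA : ∀ i, IsSymm (A i)) (ℓ : StrongDual ℂ X)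
    {ε : ℝ} (hε : 0 < ε) :
    ∃ y : X, ‖y‖ ≤ 1 ∧ ‖ℓ y - z ℓ‖ < ε ∧
      ∀ i, ‖A i (fun _ => y) - arensDiag (n i) z (A i)‖ < ε := by
  choose C hC hinc using fun i => exists_arensDiag_increment (hA i)
  obtain ⟨K₁, hK₁⟩ := Finite.bddAbove_range C
  obtain ⟨K₂, hK₂⟩ := Finite.bddAbove_range fun i => (n i : ℝ)
  set K : ℝ := max 0 (max K₁ K₂)
  have hK : 0 ≤ K := le_max_left _ _
  have hCK : ∀ i, C i ≤ K := fun i =>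
    (hK₁ ⟨i, rfl⟩).trans ((le_max_left _ _).trans (le_max_right _ _))
  have hnK : ∀ i, (n i : ℝ) ≤ K := fun i =>
    (hK₂ ⟨i, rfl⟩).trans ((le_max_right _ _).trans (le_max_right _ _))
  set η : ℝ := ε / (2 * (K + 1))
  have hη0 : 0 < η := by positivity
  have hηeq : η * (2 * (K + 1)) = ε := div_mul_cancel₀ _ (by positivity)
  obtain ⟨m, hm⟩ := exists_nat_one_div_lt hη0
  obtain ⟨y, hy, hℓ, hAy⟩ := exists_arensDiag_replace hz ℓ hK hnK
    (fun i w hw hw1 => by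
      obtain ⟨φ, hφ⟩ := hinc i z w hw hw1
      exact ⟨φ, fun d hd hd2 t ht => (hφ d hd hd2 t ht).trans (by gcongr; exact hCK i)⟩)
    hη0 (N := m + 1) m.succ_pos (m + 1) le_rfl
  have hm0 : ((m + 1 : ℕ) : ℝ) ≠ 0 := by positivity
  have hmC : ((m + 1 : ℕ) : ℂ) ≠ 0 := by exact_mod_cast m.succ_ne_zero
  rw [div_self hm0] at hy hℓ
  have hw : ι y + (1 - ((m + 1 : ℕ) : ℂ) / ((m + 1 : ℕ) : ℂ)) • z = ι y := by
    rw [div_self hmC, sub_self, zero_smul ℂ z, add_zero]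
  rw [div_self hmC, one_mul, one_mul] at hℓ
  simp only [hw, div_self hm0, one_mul, arensDiag_inclusion] at hAy
  refine ⟨y, hy, hℓ.trans_lt (by nlinarith), fun i => (hAy i).trans_lt ?_⟩
  have : K / ((m + 1 : ℕ) : ℝ) ≤ K * η := by
    rw [div_eq_mul_one_div]
    gcongr
    exact_mod_cast hm.le
  nlinarith

/-! ### Taylor polynomials of a bounded holomorphic function -/

theorem mem_ball_smul {y : X} (hy : ‖y‖ ≤ 1) {c : ℂ} (hc : ‖c‖ < 1) :
    c • y ∈ Metric.ball (0 : X) 1 := by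
  rw [mem_ball_zero_iff, norm_smul]
  exact (mul_le_of_le_one_right (norm_nonneg c) hy).trans_lt hc

theorem IsHolo.isSymm_taylorForm {g : OpenBall X → ℂ} (hg : IsHolo g) (n : ℕ) :
    IsSymm (taylorForm g n) := fun v σ => by
  have := (hg 0 (Metric.mem_ball_self one_pos)).contDiffAt.iteratedFDeriv_comp_perm v σ
  simp only [taylorForm, smul_apply, this]

theorem IsHolo.differentiableOn_slice {g : OpenBall X → ℂ} (hg : IsHolo g) {y : X}
    (hy : ‖y‖ ≤ 1) :
    DifferentiableOn ℂ (fun c : ℂ => zeroExt g (c • y)) (Metric.ball 0 1) :=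
  hg.differentiableOn.comp (differentiable_id.smul_const y).differentiableOn fun _ hc =>
    mem_ball_smul hy (mem_ball_zero_iff.1 hc)

theorem IsHolo.iteratedDeriv_slice {g : OpenBall X → ℂ} (hg : IsHolo g) (y : X) (n : ℕ) :
    iteratedDeriv n (fun c : ℂ => zeroExt g (c • y)) 0
      = iteratedFDeriv ℂ n (zeroExt g) 0 fun _ => y := by
  let L : ℂ →L[ℂ] X := ContinuousLinearMap.toSpanSingleton ℂ y
  have ho : IsOpen (L ⁻¹' Metric.ball 0 1) := Metric.isOpen_ball.preimage L.continuous
  have h0 : L 0 ∈ Metric.ball (0 : X) 1 := by simp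
  have := L.iteratedFDerivWithin_comp_right (f := zeroExt g) (n := n) (hg.contDiffOn
    Metric.isOpen_ball.uniqueDiffOn) Metric.isOpen_ball.uniqueDiffOn ho.uniqueDiffOn h0 le_rfl
  rw [iteratedFDerivWithin_of_isOpen n ho h0,
    iteratedFDerivWithin_of_isOpen n Metric.isOpen_ball h0, map_zero] at this
  rw [iteratedDeriv_eq_iteratedFDeriv]
  change iteratedFDeriv ℂ n (zeroExt g ∘ L) 0 _ = _
  rw [this]
  simp [L]

theorem IsHolo.hasSum_taylorForm {g : OpenBall X → ℂ} (hg : IsHolo g) {y : X} (hy : ‖y‖ ≤ 1)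
    {c : ℂ} (hc : ‖c‖ < 1) :
    HasSum (fun n => c ^ n * taylorForm g n fun _ => y) (g ⟨c • y, mem_ball_smul hy hc⟩) := by
  have := Complex.hasSum_taylorSeries_on_ball (hg.differentiableOn_slice hy)
    (mem_ball_zero_iff.2 hc)
  rw [zeroExt_apply _ (mem_ball_smul hy hc)] at this
  refine this.congr_fun fun n => ?_
  rw [hg.iteratedDeriv_slice]
  simp only [taylorForm, smul_apply, smul_eq_mul, sub_zero]
  ring

/-- Cauchy's estimates for the Taylor polynomials. -/
theorem IsHolo.norm_taylorForm_le {g : OpenBall X → ℂ} (hg : IsHolo g) {M : ℝ}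
    (hM : ∀ y, ‖g y‖ ≤ M) {y : X} (hy : ‖y‖ ≤ 1) (n : ℕ) :
    ‖taylorForm g n fun _ => y‖ ≤ M := by
  have hfac : (0 : ℝ) < n.factorial := by exact_mod_cast n.factorial_pos
  have hR : ∀ R : ℝ, 0 < R → R < 1 → R ^ n * ‖taylorForm g n fun _ => y‖ ≤ M := by
    intro R hR0 hR1
    have h := Complex.norm_iteratedDeriv_le_of_forall_mem_sphere_norm_le (C := M) n hR0
      ((hg.differentiableOn_slice hy).diffContOnCl_ball (Metric.closedBall_subset_ball hR1))
      fun c hc => by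
        have hc1 : ‖c‖ < 1 := by rwa [mem_sphere_zero_iff_norm.1 hc]
        rw [zeroExt_apply _ (mem_ball_smul hy hc1)]
        exact hM _
    rw [hg.iteratedDeriv_slice, le_div_iff₀ (by positivity)] at h
    simp only [taylorForm, smul_apply, smul_eq_mul, norm_mul, norm_inv, Complex.norm_natCast]
    rw [← mul_le_mul_iff_right₀ hfac]
    refine le_of_eq_of_le ?_ h
    field_simp
  have hlim : Filter.Tendsto (fun R : ℝ => R ^ n * ‖taylorForm g n fun _ => y‖)
      (nhdsWithin 1 (Set.Iio 1)) (nhds (1 ^ n * ‖taylorForm g n fun _ => y‖)) :=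
    ((Continuous.tendsto (by fun_prop) 1).mono_left nhdsWithin_le_nhds)
  rw [one_pow, one_mul] at hlim
  refine le_of_tendsto hlim ?_
  filter_upwards [Ioo_mem_nhdsLT (zero_lt_one' ℝ)] with R hR' using hR R hR'.1 hR'.2

/-! ### Existence of the Aron-Berner extension -/

theorem taylorAB_smul (g : OpenBall X → ℂ) (n : ℕ) (c : ℂ) (z : Bidual X) :
    taylorAB g n (c • z) = c ^ n * taylorAB g n z :=
  arensDiag_smul n c z _

theorem taylorAB_inclusion (g : OpenBall X → ℂ) (n : ℕ) (y : X) :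
    taylorAB g n (ι y) = taylorForm g n fun _ => y :=
  arensDiag_inclusion n y _

theorem continuous_taylorAB (g : OpenBall X → ℂ) (n : ℕ) : Continuous (taylorAB g n) :=
  (continuous_arensDiag n).clm_apply continuous_const

/-- Cauchy's estimates hold for the extended Taylor polynomials. The operator norm of the symmetric
forms would give this only up to a factor of order `eⁿ`. -/
theorem IsHolo.norm_taylorAB_le {g : OpenBall X → ℂ} (hg : IsHolo g) {M : ℝ}
    (hM : ∀ y, ‖g y‖ ≤ M) {z : Bidual X} (hz : ‖z‖ ≤ 1) (n : ℕ) : ‖taylorAB g n z‖ ≤ M := by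
  refine le_of_forall_pos_le_add fun ε hε => ?_
  obtain ⟨y, hy, -, h⟩ := exists_arensDiag_approx hz (κ := Unit) (n := fun _ => n)
    (A := fun _ => taylorForm g n) (fun _ => hg.isSymm_taylorForm n) 0 hε
  have h1 := hg.norm_taylorForm_le hM hy n
  have h2 := norm_le_norm_add_norm_sub' (taylorAB g n z) (taylorForm g n fun _ => y)
  have h3 := h ()
  rw [norm_sub_rev] at h3
  have h4 : ‖taylorAB g n z - taylorForm g n fun _ => y‖ < ε := h3
  linarith

theorem IsHolo.norm_taylorAB_le_pow {g : OpenBall X → ℂ} (hg : IsHolo g) {M : ℝ}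
    (hM : ∀ y, ‖g y‖ ≤ M) {z : Bidual X} {ρ : ℝ} (hρ : 0 < ρ) (hz : ‖z‖ ≤ ρ) (n : ℕ) :
    ‖taylorAB g n z‖ ≤ ρ ^ n * M := by
  have hρC : (ρ : ℂ) ≠ 0 := by exact_mod_cast hρ.ne'
  have hρn : ‖(ρ : ℂ)‖ = ρ := by rw [Complex.norm_real, Real.norm_of_nonneg hρ.le]
  have hz' : ‖(ρ : ℂ)⁻¹ • z‖ ≤ 1 := by
    refine (z.opNorm_smul_le _).trans ?_
    rwa [norm_inv, hρn, inv_mul_le_iff₀ hρ, mul_one]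
  have h := hg.norm_taylorAB_le hM hz' n
  rw [taylorAB_smul, norm_mul, norm_pow, norm_inv, hρn, inv_pow,
    inv_mul_le_iff₀ (by positivity)] at h
  exact h

/-- The sum of the extended Taylor series at `c • z`. For `‖z‖ = 1` this describes the Aron-Berner
extension along the radius through `z`. -/
def radialSum (g : OpenBall X → ℂ) (c : ℂ) (z : Bidual X) : ℂ := ∑' n, c ^ n * taylorAB g n z

theorem norm_pow_mul_le {a c : ℂ} {M ρ : ℝ} (ha : ‖a‖ ≤ M) (hc : ‖c‖ ≤ ρ) (n : ℕ) :
    ‖c ^ n * a‖ ≤ ρ ^ n * M := by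
  rw [norm_mul, norm_pow]
  have := norm_nonneg a
  have := (norm_nonneg c).trans hc
  gcongr

theorem summable_pow_mul_const {ρ : ℝ} (h0 : 0 ≤ ρ) (h1 : ρ < 1) (M : ℝ) :
    Summable fun n : ℕ => ρ ^ n * M :=
  (summable_geometric_of_lt_one h0 h1).mul_right M

theorem IsHolo.hasSum_radialSum {g : OpenBall X → ℂ} (hg : IsHolo g) {M : ℝ}
    (hM : ∀ y, ‖g y‖ ≤ M) {z : Bidual X} (hz : ‖z‖ ≤ 1) {c : ℂ} (hc : ‖c‖ < 1) :
    HasSum (fun n => c ^ n * taylorAB g n z) (radialSum g c z) :=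
  ((summable_pow_mul_const (norm_nonneg c) hc M).of_norm_bounded fun n =>
    norm_pow_mul_le (hg.norm_taylorAB_le hM hz n) le_rfl n).hasSum

/-- A power series whose first `N` coefficients are at most `η`, and the others at most `M`. -/
theorem norm_tsum_pow_mul_le {a : ℕ → ℂ} {M η ρ : ℝ} {N : ℕ} {c s : ℂ} (hη0 : 0 ≤ η)
    (hρ1 : ρ < 1)
    (hc : ‖c‖ ≤ ρ) (ha : ∀ n, ‖a n‖ ≤ M) (haN : ∀ n < N, ‖a n‖ ≤ η)
    (hs : HasSum (fun n => c ^ n * a n) s) : ‖s‖ ≤ (η + ρ ^ N * M) * (1 - ρ)⁻¹ := by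
  have hρ0 : 0 ≤ ρ := (norm_nonneg c).trans hc
  have hM : 0 ≤ M := (norm_nonneg _).trans (ha 0)
  have hgeom := hasSum_geometric_of_lt_one hρ0 hρ1
  rw [← hs.tsum_eq, ← hs.summable.sum_add_tsum_nat_add N, add_mul, add_comm]
  have h1 : ‖∑ n ∈ Finset.range N, c ^ n * a n‖ ≤ η * (1 - ρ)⁻¹ := calc
    _ ≤ ∑ n ∈ Finset.range N, ρ ^ n * η := norm_sum_le_of_le _ fun n hn =>
        norm_pow_mul_le (haN n (Finset.mem_range.1 hn)) hc n
    _ = (∑ n ∈ Finset.range N, ρ ^ n) * η := (Finset.sum_mul ..).symm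
    _ ≤ (1 - ρ)⁻¹ * η := by
        gcongr
        exact sum_le_hasSum _ (fun _ _ => by positivity) hgeom
    _ = η * (1 - ρ)⁻¹ := mul_comm ..
  have h2 : ‖∑' n, c ^ (n + N) * a (n + N)‖ ≤ (1 - ρ)⁻¹ * (ρ ^ N * M) := by
    refine tsum_of_norm_bounded (hgeom.mul_right _) fun n => ?_
    rw [← mul_assoc, ← pow_add]
    exact norm_pow_mul_le (ha _) hc _
  refine (norm_add_le _ _).trans ?_
  linarith

/-- A single point `y` of the closed ball approximates `z`, both on a functional and for the values
of `g` and its extension on the discs `{c • y}` and `{c • z}`, uniformly for `‖c‖ ≤ ρ < 1`. -/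
theorem IsHolo.exists_radialSum_approx {g : OpenBall X → ℂ} (hg : IsHolo g) {M : ℝ}
    (hM : ∀ y, ‖g y‖ ≤ M) {z : Bidual X} (hz : ‖z‖ ≤ 1) (ℓ : StrongDual ℂ X) {ρ : ℝ}
    (hρ0 : 0 ≤ ρ) (hρ : ρ < 1) {ε : ℝ} (hε : 0 < ε) :
    ∃ y : X, ∃ hy : ‖y‖ ≤ 1, ‖ℓ y - z ℓ‖ < ε ∧ ∀ c : ℂ, ∀ hc : ‖c‖ ≤ ρ,
      ‖g ⟨c • y, mem_ball_smul hy (hc.trans_lt hρ)⟩ - radialSum g c z‖ < ε := by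
  have h1ρ : 0 < 1 - ρ := sub_pos.2 hρ
  have hlim : Tendsto (fun N : ℕ => ρ ^ N * (2 * M)) atTop (𝓝 (0 * (2 * M))) :=
    (tendsto_pow_atTop_nhds_zero_of_lt_one hρ0 hρ).mul_const _
  rw [zero_mul] at hlim
  set η : ℝ := ε * (1 - ρ) / 3 with hη
  have hη0 : 0 < η := by positivity
  obtain ⟨N, hN⟩ := (hlim.eventually_lt_const hη0).exists
  obtain ⟨y, hy, hℓ, hA⟩ := exists_arensDiag_approx hz (κ := Fin N) (n := fun i => i)
    (A := fun i => taylorForm g i) (fun i => hg.isSymm_taylorForm i) ℓ (lt_min hε hη0)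
  refine ⟨y, hy, hℓ.trans_le (min_le_left _ _), fun c hc => ?_⟩
  have hs := (hg.hasSum_taylorForm hy (hc.trans_lt hρ)).sub
    (hg.hasSum_radialSum hM hz (hc.trans_lt hρ))
  simp only [← mul_sub] at hs
  refine (norm_tsum_pow_mul_le (M := 2 * M) (N := N) hη0.le hρ hc (fun n => ?_) (fun n hn => ?_)
    hs).trans_lt ?_
  · refine (norm_sub_le _ _).trans ?_
    linarith [hg.norm_taylorForm_le hM hy n, hg.norm_taylorAB_le hM hz n]
  · exact (hA ⟨n, hn⟩).le.trans (min_le_right _ _)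
  · rw [← div_eq_mul_inv, div_lt_iff₀ h1ρ]
    nlinarith

theorem continuous_radialSum {g : OpenBall X → ℂ} (hg : IsHolo g) {M : ℝ}
    (hM : ∀ y, ‖g y‖ ≤ M) {c : ℂ} (hc : ‖c‖ < 1) :
    Continuous fun z : ClosedBall (Bidual X) => radialSum g c z.1 :=
  continuous_tsum (fun n => continuous_const.mul
      ((continuous_taylorAB g n).comp continuous_subtype_val))
    (summable_pow_mul_const (norm_nonneg c) hc M)
    fun n z => norm_pow_mul_le (hg.norm_taylorAB_le hM (ClosedBall.norm_le z) n) le_rfl n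

/-- Differences of the extended series along radii are controlled by differences of `g`. -/
theorem IsHolo.norm_radialSum_sub_le {g : OpenBall X → ℂ} (hg : IsHolo g) {M : ℝ}
    (hM : ∀ y, ‖g y‖ ≤ M) {δ ε : ℝ}
    (hδ : ∀ a b : OpenBall X, dist a b < δ → dist (g a) (g b) ≤ ε) {c c' : ℂ} (hc : ‖c‖ < 1)
    (hc' : ‖c'‖ < 1) (hcc : ‖c - c'‖ < δ) {z : Bidual X} (hz : ‖z‖ ≤ 1) :
    ‖radialSum g c z - radialSum g c' z‖ ≤ ε := by
  refine le_of_forall_pos_le_add fun η hη => ?_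
  obtain ⟨y, hy, -, h⟩ := hg.exists_radialSum_approx hM hz 0
    (le_max_of_le_left (norm_nonneg c)) (max_lt hc hc') (half_pos hη)
  have h1 := h c (le_max_left _ _)
  have h2 := h c' (le_max_right _ _)
  have h3 := hδ ⟨c • y, mem_ball_smul hy hc⟩ ⟨c' • y, mem_ball_smul hy hc'⟩ (by
    rw [Subtype.dist_eq, dist_eq_norm, ← sub_smul, norm_smul]
    exact (mul_le_of_le_one_right (norm_nonneg _) hy).trans_lt hcc)
  rw [← dist_eq_norm] at h1 h2 ⊢
  rw [dist_comm] at h1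
  linarith [dist_triangle4 (radialSum g c z) (g ⟨c • y, mem_ball_smul hy hc⟩)
    (g ⟨c' • y, mem_ball_smul hy hc'⟩) (radialSum g c' z)]

/-- The sequence `k / (k + 1)` of radii increasing to one. -/
def radius (k : ℕ) : ℂ := k / (k + 1)

theorem tendsto_radius : Tendsto radius atTop (𝓝 1) := tendsto_natCast_div_add_atTop (1 : ℂ)

theorem norm_radius_lt (k : ℕ) : ‖radius k‖ < 1 := by
  have h : ‖(k + 1 : ℂ)‖ = k + 1 := by exact_mod_cast Complex.norm_natCast (k + 1)
  rw [radius, norm_div, h, Complex.norm_natCast, div_lt_one (by positivity)]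
  linarith

/-- The Aron-Berner extension after dilation by `radius k`, as a bounded function on the
closed ball. -/
def radialBCF {g : OpenBall X →ᵇ ℂ} (hg : IsHolo g) (k : ℕ) : ClosedBall (Bidual X) →ᵇ ℂ :=
  BoundedContinuousFunction.ofNormedAddCommGroup (fun z => radialSum g (radius k) z.1)
    (continuous_radialSum hg g.norm_coe_le_norm (norm_radius_lt k)) (∑' n, ‖radius k‖ ^ n * ‖g‖)
    fun z => tsum_of_norm_bounded
      (summable_pow_mul_const (norm_nonneg _) (norm_radius_lt k) ‖g‖).hasSum fun n =>
        norm_pow_mul_le (hg.norm_taylorAB_le g.norm_coe_le_norm (ClosedBall.norm_le z) n) le_rfl n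

theorem cauchySeq_radialBCF {g : OpenBall X →ᵇ ℂ} (hg : IsHolo g) (huc : UniformContinuous g) :
    CauchySeq (radialBCF hg) := by
  refine Metric.cauchySeq_iff.2 fun ε hε => ?_
  obtain ⟨δ, hδ, h⟩ := Metric.uniformContinuous_iff.1 huc (ε / 2) (half_pos hε)
  obtain ⟨K, hK⟩ := Metric.cauchySeq_iff.1 tendsto_radius.cauchySeq δ hδ
  refine ⟨K, fun m hm n hn => lt_of_le_of_lt ?_ (half_lt_self hε)⟩
  refine (BoundedContinuousFunction.dist_le (half_pos hε).le).2 fun z => ?_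
  rw [dist_eq_norm]
  exact hg.norm_radialSum_sub_le g.norm_coe_le_norm (fun a b hab => (h hab).le)
    (norm_radius_lt m) (norm_radius_lt n) (by rw [← dist_eq_norm]; exact hK m hm n hn)
    (ClosedBall.norm_le z)

/-- In the open bidual ball the extended Taylor series converges, and its dilations converge to
it. -/
theorem IsHolo.tendsto_radialSum {g : OpenBall X → ℂ} (hg : IsHolo g) {M : ℝ}
    (hM : ∀ y, ‖g y‖ ≤ M) {z : Bidual X} (hz : ‖z‖ < 1) :
    Summable (fun n => taylorAB g n z) ∧
      Tendsto (fun k => radialSum g (radius k) z) atTop (𝓝 (∑' n, taylorAB g n z)) := by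
  obtain ⟨ρ, hρz, hρ1⟩ := exists_between hz
  have hρ0 : 0 < ρ := z.opNorm_nonneg.trans_lt hρz
  have hbd := hg.norm_taylorAB_le_pow hM hρ0 hρz.le
  have hsum := summable_pow_mul_const hρ0.le hρ1 M
  have hlim : Tendsto (fun k => radialSum g (radius k) z) atTop
      (𝓝 (∑' n, 1 ^ n * taylorAB g n z)) :=
    tendsto_tsum_of_dominated_convergence hsum (fun n => (tendsto_radius.pow n).mul_const _)
      (Eventually.of_forall fun k n => by
        rw [norm_mul, norm_pow]
        exact (mul_le_of_le_one_left (norm_nonneg _)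
          (pow_le_one₀ (norm_nonneg _) (norm_radius_lt k).le)).trans (hbd n))
  simp only [one_pow, one_mul] at hlim
  exact ⟨hsum.of_norm_bounded hbd, hlim⟩

theorem OpenBall.norm_lt {Y : Type*} [NormedAddCommGroup Y] (y : OpenBall Y) : ‖y.1‖ < 1 :=
  mem_ball_zero_iff.1 y.2

theorem isAronBerner_of_tendsto {g : OpenBall X →ᵇ ℂ} (hg : IsHolo g)
    {G : ClosedBall (Bidual X) →ᵇ ℂ} (hG : Tendsto (radialBCF hg) atTop (𝓝 G)) :
    IsAronBerner g G := by
  refine And.intro G.continuous fun z => ?_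
  have h := hg.tendsto_radialSum g.norm_coe_le_norm (OpenBall.norm_lt z)
  have hGz : Tendsto (fun k => radialBCF hg k (toClosed z)) atTop (𝓝 (G (toClosed z))) :=
    ((continuous_eval_const (toClosed z)).tendsto G).comp hG
  rw [tendsto_nhds_unique hGz h.2]
  exact h.1.hasSum

theorem exists_isAronBerner {g : OpenBall X →ᵇ ℂ} (hg : g ∈ Au X) :
    ∃ G : ClosedBall (Bidual X) → ℂ, IsAronBerner g G := by
  obtain ⟨G, hG⟩ := cauchySeq_tendsto_of_complete (cauchySeq_radialBCF hg.1 hg.2)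
  exact ⟨G, isAronBerner_of_tendsto hg.1 hG⟩

/-! ### Values of the Aron-Berner extension -/

/-- The points `radius k • y` of the open ball. -/
def radialPoint {Y : Type*} [NormedAddCommGroup Y] [NormedSpace ℂ Y] (y : ClosedBall Y) (k : ℕ) :
    OpenBall Y :=
  ⟨radius k • y.1, mem_ball_smul (ClosedBall.norm_le y) (norm_radius_lt k)⟩

theorem tendsto_radialPoint {Y : Type*} [NormedAddCommGroup Y] [NormedSpace ℂ Y]
    (y : ClosedBall Y) : Tendsto (fun k => toClosed (radialPoint y k)) atTop (𝓝 y) := by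
  refine tendsto_subtype_rng.2 ?_
  have := tendsto_radius.smul_const y.1
  rwa [one_smul] at this

theorem IsAronBerner.apply_radialPoint {g : OpenBall X → ℂ} {G : ClosedBall (Bidual X) → ℂ}
    (hG : IsAronBerner g G) (z : ClosedBall (Bidual X)) (k : ℕ) :
    G (toClosed (radialPoint z k)) = radialSum g (radius k) z.1 := by
  rw [← (hG.2 _).tsum_eq]
  exact tsum_congr fun n => taylorAB_smul g n _ _

/-- The values of an Aron-Berner extension are limits of values of the function itself, along
points that converge to `z` on a prescribed functional. -/
theorem IsAronBerner.exists_approx {g : OpenBall X →ᵇ ℂ} (hg : IsHolo g)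
    {G : ClosedBall (Bidual X) → ℂ} (hG : IsAronBerner g G) (z : ClosedBall (Bidual X))
    (ℓ : StrongDual ℂ X) {ε : ℝ} (hε : 0 < ε) :
    ∃ u : OpenBall X, ‖g u - G z‖ < ε ∧ ‖ℓ u.1 - z.1 ℓ‖ < ε := by
  have h1 : Tendsto (fun k => radialSum g (radius k) z.1) atTop (𝓝 (G z)) := by
    simp only [← hG.apply_radialPoint]
    exact (hG.1.tendsto z).comp (tendsto_radialPoint z)
  have h2 : Tendsto (fun k => radius k * z.1 ℓ) atTop (𝓝 (z.1 ℓ)) := by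
    simpa using tendsto_radius.mul_const (z.1 ℓ)
  obtain ⟨k, hk1, hk2⟩ := ((Metric.tendsto_nhds.1 h1 _ (half_pos hε)).and
    (Metric.tendsto_nhds.1 h2 _ (half_pos hε))).exists
  obtain ⟨y, hy, hℓ, h⟩ := hg.exists_radialSum_approx g.norm_coe_le_norm (ClosedBall.norm_le z) ℓ
    (norm_nonneg (radius k)) (norm_radius_lt k) (half_pos hε)
  refine ⟨⟨radius k • y, mem_ball_smul hy (norm_radius_lt k)⟩, ?_, ?_⟩
  · have h3 := h (radius k) le_rfl
    rw [← dist_eq_norm] at h3 ⊢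
    linarith [dist_triangle (g ⟨radius k • y, mem_ball_smul hy (norm_radius_lt k)⟩)
      (radialSum g (radius k) z.1) (G z)]
  · rw [dist_eq_norm] at hk2
    have e : ℓ (radius k • y) - z.1 ℓ = radius k * (ℓ y - z.1 ℓ) + (radius k * z.1 ℓ - z.1 ℓ) := by
      rw [map_smul, smul_eq_mul]; ring
    have h4 : ‖radius k * (ℓ y - z.1 ℓ)‖ < ε / 2 := by
      rw [norm_mul]
      exact (mul_le_of_le_one_left (norm_nonneg _) (norm_radius_lt k).le).trans_lt hℓ
    change ‖ℓ (radius k • y) - z.1 ℓ‖ < ε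
    rw [e]
    exact (norm_add_le _ _).trans_lt (by linarith)

theorem continuous_toBidualBall : Continuous (toBidualBall : ClosedBall X → _) :=
  ((ι).continuous.comp continuous_subtype_val).subtype_mk _

/-- The Aron-Berner extension of `g` extends the continuous extension of `g` to the closed ball. -/
theorem IsAronBerner.apply_toBidualBall {g : OpenBall X → ℂ} (hg : IsHolo g)
    {G : ClosedBall (Bidual X) → ℂ} (hG : IsAronBerner g G) {F : ClosedBall X → ℂ}
    (hF : Continuous F) (hFg : ∀ y : OpenBall X, F (toClosed y) = g y) (x : ClosedBall X) :
    G (toBidualBall x) = F x := by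
  have h1 : Tendsto (fun k => G (toBidualBall (toClosed (radialPoint x k)))) atTop
      (𝓝 (G (toBidualBall x))) :=
    ((hG.1.comp continuous_toBidualBall).tendsto x).comp (tendsto_radialPoint x)
  have h2 : Tendsto (fun k => F (toClosed (radialPoint x k))) atTop (𝓝 (F x)) :=
    (hF.tendsto x).comp (tendsto_radialPoint x)
  refine tendsto_nhds_unique (h1.congr fun k => ?_) h2
  have e : toBidualBall (toClosed (radialPoint x k)) = toClosed (radialPoint (toBidualBall x) k) :=
    Subtype.ext ((ι).map_smul (radius k) x.1)
  rw [hFg, e, hG.apply_radialPoint, radialSum]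
  have h3 := hg.hasSum_taylorForm (ClosedBall.norm_le x) (norm_radius_lt k)
  refine Eq.trans (tsum_congr fun n => ?_) h3.tsum_eq
  rw [← taylorAB_inclusion]
  rfl

/-! ### Strong peak points and fibers -/

theorem norm_le_one_of_strongPeak {Ω : Type*} [MetricSpace Ω] {F : Ω → ℂ} {x : Ω} (h1 : F x = 1)
    (h : ∀ ε > 0, ∃ δ > 0, ∀ y, ε < dist x y → ‖F y‖ < 1 - δ) (y : Ω) : ‖F y‖ ≤ 1 := by
  by_cases hxy : x = y
  · rw [← hxy, h1, norm_one]
  · obtain ⟨δ, hδ, H⟩ := h _ (half_pos (dist_pos.2 hxy))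
    linarith [H y (half_lt_self (dist_pos.2 hxy))]

/-- If `|G z| ≥ 1`, then `z` is approximated on any functional `ℓ` by points `u` of the ball with
`|g u|` close to one, hence close in norm to the peak point `x`; so `z ℓ = ℓ x` for all `ℓ`. -/
theorem IsAronBerner.norm_lt_one_of_strongPeak {g : OpenBall X →ᵇ ℂ} (hg : IsHolo g)
    {G : ClosedBall (Bidual X) → ℂ} (hG : IsAronBerner g G) {F : ClosedBall X → ℂ}
    (hFg : ∀ y : OpenBall X, F (toClosed y) = g y) {x : ClosedBall X}
    (h : ∀ ε > 0, ∃ δ > 0, ∀ y, ε < dist x y → ‖F y‖ < 1 - δ) {z : ClosedBall (Bidual X)}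
    (hz : z ≠ toBidualBall x) : ‖G z‖ < 1 := by
  by_contra! hGz
  obtain ⟨ℓ, hℓ⟩ : ∃ ℓ : StrongDual ℂ X, z.1 ℓ ≠ ℓ x.1 := by
    by_contra! hall
    exact hz (Subtype.ext (ContinuousLinearMap.ext hall))
  have hα : 0 < ‖z.1 ℓ - ℓ x.1‖ := norm_pos_iff.2 (sub_ne_zero.2 hℓ)
  set α := ‖z.1 ℓ - ℓ x.1‖
  obtain ⟨δ, hδ, H⟩ := h (α / (2 * (‖ℓ‖ + 1))) (by positivity)
  obtain ⟨u, hu, huℓ⟩ := hG.exists_approx hg z ℓ (lt_min hδ (half_pos hα))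
  have hgu : 1 - δ ≤ ‖F (toClosed u)‖ := by
    rw [hFg]
    linarith [norm_le_norm_add_norm_sub' (G z) (g u), norm_sub_rev (G z) (g u),
      hu.trans_le (min_le_left _ _)]
  have hd : dist x (toClosed u) ≤ α / (2 * (‖ℓ‖ + 1)) := not_lt.1 fun hlt => (H _ hlt).not_ge hgu
  have h1 : ‖ℓ u.1 - ℓ x.1‖ ≤ α / 2 := calc
    ‖ℓ u.1 - ℓ x.1‖ ≤ ‖ℓ‖ * ‖u.1 - x.1‖ := by rw [← map_sub]; exact ℓ.le_opNorm _
    _ ≤ (‖ℓ‖ + 1) * (α / (2 * (‖ℓ‖ + 1))) := by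
      rw [dist_comm, Subtype.dist_eq, dist_eq_norm] at hd
      gcongr
      · linarith
      · exact hd
    _ = α / 2 := by field_simp
  have h2 := norm_sub_le_norm_sub_add_norm_sub (z.1 ℓ) (ℓ u.1) (ℓ x.1)
  rw [norm_sub_rev (z.1 ℓ) (ℓ u.1)] at h2
  linarith [huℓ.trans_le (min_le_right _ _)]

/-- Multiplication by high powers of a strong peak function kills functions that vanish
continuously at the peak point. -/
theorem tendsto_pow_mul_of_strongPeak {Y : Type*} [NormedAddCommGroup Y]
    {g h : OpenBall Y →ᵇ ℂ} {F : ClosedBall Y → ℂ}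
    (hFg : ∀ y : OpenBall Y, F (toClosed y) = g y) {x : ClosedBall Y} (hF1 : F x = 1)
    (hpeak : ∀ ε > 0, ∃ δ > 0, ∀ y, ε < dist x y → ‖F y‖ < 1 - δ)
    (hh : ∀ ε > 0, ∃ η > 0, ∀ y : OpenBall Y, dist y.1 x.1 < η → ‖h y‖ ≤ ε) :
    Tendsto (fun n : ℕ => g ^ n * h) atTop (𝓝 0) := by
  refine Metric.tendsto_nhds.2 fun ε hε => ?_
  obtain ⟨η, hη, hηh⟩ := hh (ε / 2) (half_pos hε)
  obtain ⟨δ, hδ, H⟩ := hpeak (η / 2) (half_pos hη)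
  have hg1 : ∀ y, ‖g y‖ ≤ 1 := fun y => by
    rw [← hFg]
    exact norm_le_one_of_strongPeak hF1 hpeak _
  -- the maximum guards against `δ > 1`, when there are no points far from `x`
  have hlim : Tendsto (fun n : ℕ => max 0 (1 - δ) ^ n * ‖h‖) atTop (𝓝 (0 * ‖h‖)) :=
    (tendsto_pow_atTop_nhds_zero_of_lt_one (le_max_left _ _)
      (max_lt one_pos (by linarith))).mul_const _
  rw [zero_mul] at hlim
  filter_upwards [hlim.eventually_le_const (half_pos hε)] with n hn
  rw [dist_zero_right]
  refine lt_of_le_of_lt ?_ (half_lt_self hε)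
  refine (BoundedContinuousFunction.norm_le (half_pos hε).le).2 fun y => ?_
  have e : (g ^ n * h) y = g y ^ n * h y := rfl
  rw [e, norm_mul, norm_pow]
  by_cases hy : dist y.1 x.1 < η
  · exact (mul_le_of_le_one_left (norm_nonneg _) (pow_le_one₀ (norm_nonneg _) (hg1 y))).trans
      (hηh y hy)
  · have hlt : ‖F (toClosed y)‖ < 1 - δ := H _ (by
      rw [dist_comm]
      exact (half_lt_self hη).trans_le (not_lt.1 hy))
    rw [hFg] at hlt
    refine le_trans ?_ hn
    gcongr
    · exact hlt.le.trans (le_max_right _ _)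
    · exact h.norm_coe_le_norm y

/-- A character in the fiber takes the value one at the peak function `p`, so it has the same value
at `f - E x` and at `pⁿ (f - E x)`, and these products tend to zero. -/
theorem apply_eq_of_mem_polynomialFiber {H : Subalgebra ℂ (OpenBall X →ᵇ ℂ)} {hAu : Au X ≤ H}
    {x : ClosedBall X} {F : ClosedBall X → ℂ} (hF : Continuous F) {g : OpenBall X →ᵇ ℂ}
    (hg : g ∈ Au X) (hFg : ∀ y : OpenBall X, F (toClosed y) = g y) (hF1 : F x = 1)
    (hpeak : ∀ ε > 0, ∃ δ > 0, ∀ y, ε < dist x y → ‖F y‖ < 1 - δ) (f : H) {E : X → ℂ}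
    (hE : ContinuousOn E (insert x.1 (Metric.ball (0 : X) 1)))
    (hEf : ∀ y : OpenBall X, E y = (f : OpenBall X →ᵇ ℂ) y)
    {τ : WeakDual.characterSpace ℂ H} (hτ : τ ∈ polynomialFiber H hAu (toBidualBall x)) :
    τ f = E x.1 := by
  obtain ⟨G, hG⟩ := exists_isAronBerner hg
  let p : H := Subalgebra.inclusion hAu ⟨g, hg⟩
  have hp : τ p = 1 := by
    rw [hτ ⟨g, hg⟩ G hG, hG.apply_toBidualBall hg.1 hF hFg, hF1]
  let h : H := f - algebraMap ℂ H (E x.1)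
  have hh : ∀ y, (h : OpenBall X →ᵇ ℂ) y = E y.1 - E x.1 := fun y => by
    rw [hEf]; rfl
  have hlim : Tendsto (fun n : ℕ => p ^ n * h) atTop (𝓝 0) := by
    refine tendsto_subtype_rng.2 (tendsto_pow_mul_of_strongPeak hFg hF1 hpeak fun ε hε => ?_)
    obtain ⟨η, hη, hηE⟩ := Metric.continuousWithinAt_iff.1 (hE x.1 (Set.mem_insert _ _)) ε hε
    refine ⟨η, hη, fun y hy => ?_⟩
    rw [hh, ← dist_eq_norm]
    exact (hηE (Set.mem_insert_of_mem _ y.2) hy).le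
  have hτlim : Tendsto (fun n : ℕ => τ (p ^ n * h)) atTop (𝓝 (τ 0)) :=
    ((map_continuous τ).tendsto 0).comp hlim
  simp only [map_mul, map_pow, hp, one_pow, one_mul, map_zero] at hτlim
  have h0 : τ h = 0 := tendsto_nhds_unique tendsto_const_nhds hτlim
  rw [map_sub, AlgHomClass.commutes] at h0
  exact sub_eq_zero.1 h0

end PolyFiber

end

theorem theorem4p8 {X : Type*} [NormedAddCommGroup X] [NormedSpace ℂ X] [CompleteSpace X]
    (x : PolyFiber.ClosedBall X)
    (hx : PolyFiber.IsStrongPeakPoint (PolyFiber.auClosedBall X) x) :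
    PolyFiber.IsPeakPoint (PolyFiber.auBidualBall X) (PolyFiber.toBidualBall x) ∧
    ∀ (H : Subalgebra ℂ (PolyFiber.OpenBall X →ᵇ ℂ)) (hAu : PolyFiber.Au X ≤ H),
      H ≤ PolyFiber.HInf X →
      ∀ f : H, PolyFiber.ExtendsContinuouslyTo (f : PolyFiber.OpenBall X →ᵇ ℂ) (x : X) →
        ∃ c : ℂ, ∀ τ ∈ PolyFiber.polynomialFiber H hAu (PolyFiber.toBidualBall x),
          WeakDual.gelfandTransform ℂ H f τ = c := by
  obtain ⟨F, ⟨hF, g, hg, hFg⟩, hF1, hpeak⟩ := hx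
  obtain ⟨G, hG⟩ := PolyFiber.exists_isAronBerner hg
  refine ⟨⟨G, ⟨g, hg, hG⟩, (hG.apply_toBidualBall hg.1 hF hFg x).trans hF1,
    fun z hz => hG.norm_lt_one_of_strongPeak hg.1 hFg hpeak hz⟩, ?_⟩
  rintro H hAu - f ⟨E, hE, hEf⟩
  exact ⟨E x, fun τ hτ =>
    PolyFiber.apply_eq_of_mem_polynomialFiber hF hg hFg hF1 hpeak f hE hEf hτ⟩
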